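/- Let $(X,\mathcal F,m)$ be a probability space and let $\{T_t\}_{t\ge 0}$ be a symmetric Markov semigroup on the real space $L^2(X,\mathcal F,m)$, i.e. a strongly continuous semigroup of symmetric contractions such that $0\le f\le 1$ $m$-a.e. implies $0\le T_tf\le 1$ $m$-a.e. Let $L$ be its generator. Each $T_t$ extends by continuity to a contraction of $L^1(X,\mathcal F,m)$, denoted again by $T_t$. Let $\sqrt{-L}$ be the non-negative self-adjoint square root of $-L$ in $L^2$; equivalently (Balakrishnan's formula), $$\sqrt{-L}\,f=\lim_{\varepsilon\downarrow 0}\frac1{2\sqrt\pi}\int_\varepsilon^\infty s^{-3/2}\,(f-T_sf)\,ds \quad\text{in } L^2,$$ $D(\sqrt{-L})$ being the set of all $f\in L^2$ for which this limit exists. For $f,g\in L^1$ write $f\in D_1(\sqrt{-L})$ and $\sqrt{-L}f=g$ if there are $f_n\in D(\sqrt{-L})$ such that $f_n\to f$ and $\sqrt{-L}f_n\to g$ in $L^1$. For $h\in L^1$ and $t>0$ put $$A_th(x)=\frac1t\int_t^{2t}T_sh(x)\,ds ,$$ where $(s,x)\mapsto T_sh(x)$ is a jointly measurable function that for every $s\ge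 0$ represents the class $T_sh\in L^1$ (a jointly measurable version). Theorem. There is a universal constant $C>0$ such that, for every such $X$, $m$ and $\{T_t\}$, every $f\in D_1(\sqrt{-L})$ and every $g\in L^1$ with $\sqrt{-L}f=g$ in the above sense, the following holds. Jointly measurable versions of $T_sf(x)$ and of $T_s|g|(x)$ exist, and for any choice of such versions, for $m$-a.e. $x\in X$, the functions $s\mapsto T_sf(x)$ and $s\mapsto T_s|g|(x)$ are integrable over $[t,2t]$ for every $t>0$, and for all $t>0$ simultaneously $$|A_tf(x)-f(x)|\le C\sqrt t\,\sup_{s>0}A_s|\sqrt{-L}f|(x),$$ where the supremum is taken in $[0,\infty]$. -/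

import Mathlib

open MeasureTheory Filter Topology
open scoped ENNReal

noncomputable section

namespace SymmMarkov

variable {X : Type*} [MeasurableSpace X]

/-- A symmetric Markov semigroup `(T_t)_{t ≥ 0}` on the real space `L²(X, m)`: a strongly continuous
semigroup of symmetric contractions such that `0 ≤ f ≤ 1` a.e. implies `0 ≤ T_t f ≤ 1` a.e.
(the conservative case `T_t 1 = 1` is included, but not required).
Only the values `T t` with `t ≥ 0` are meaningful. -/
structure SymmMarkovSemigroup (m : Measure X) where
  T : ℝ → (Lp ℝ 2 m →L[ℝ] Lp ℝ 2 m)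
  map_zero : T 0 = ContinuousLinearMap.id ℝ (Lp ℝ 2 m)
  map_add : ∀ s t : ℝ, 0 ≤ s → 0 ≤ t → T (s + t) = (T s).comp (T t)
  symmetric : ∀ t : ℝ, 0 ≤ t → ∀ f g : Lp ℝ 2 m, inner ℝ (T t f) g = inner ℝ f (T t g)
  contraction : ∀ t : ℝ, 0 ≤ t → ∀ f : Lp ℝ 2 m, ‖T t f‖ ≤ ‖f‖
  markov : ∀ t : ℝ, 0 ≤ t → ∀ f : Lp ℝ 2 m, (∀ᵐ x ∂m, 0 ≤ f x ∧ f x ≤ 1) →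
    ∀ᵐ x ∂m, 0 ≤ T t f x ∧ T t f x ≤ 1
  strongly_continuous : ∀ f : Lp ℝ 2 m, Tendsto (fun t => T t f) (𝓝[>] 0) (𝓝 f)

section L1

variable {m : Measure X} [IsProbabilityMeasure m]

variable (m) in
/-- The inclusion `L²(m) ⊆ L¹(m)` (the measure is a probability). -/
def toL1 : Lp ℝ 2 m →ₗ[ℝ] Lp ℝ 1 m where
  toFun f := ⟨f.1, Lp.antitone one_le_two f.2⟩
  map_add' _ _ := rfl
  map_smul' _ _ := rfl

theorem coeFn_toL1 (f : Lp ℝ 2 m) : (toL1 m f : X → ℝ) = f := rfl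

theorem denseRange_toL1 : DenseRange (toL1 m) := by
  refine (Lp.simpleFunc.denseRange (E := ℝ) (μ := m) ENNReal.one_ne_top).mono ?_
  rintro _ ⟨s, rfl⟩
  have h2 : MemLp (Lp.simpleFunc.toSimpleFunc s) 2 m :=
    SimpleFunc.memLp_of_isFiniteMeasure _ _ _
  refine ⟨h2.toLp _, ?_⟩
  apply Lp.ext
  rw [coeFn_toL1]
  exact h2.coeFn_toLp.trans (Lp.simpleFunc.toSimpleFunc_eq_toFun s)

/-- Symmetry and the Markov property give `‖T_t f‖₁ ≤ ‖f‖₁` for `f ∈ L²`. -/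
theorem SymmMarkovSemigroup.norm_toL1_le (S : SymmMarkovSemigroup m) {t : ℝ} (ht : 0 ≤ t)
    (f : Lp ℝ 2 m) : ‖toL1 m (S.T t f)‖ ≤ ‖toL1 m f‖ := by
  -- test `T_t f` against the indicators of `{T_t f ≥ 0}` and of its complement
  set h : Lp ℝ 2 m := S.T t f with hh
  have hmeas : StronglyMeasurable (h : X → ℝ) := Lp.stronglyMeasurable h
  set A : Set X := {x | 0 ≤ h x} with hA
  have hAm : MeasurableSet A := measurableSet_le measurable_const hmeas.measurable
  set a : Lp ℝ 2 m := indicatorConstLp 2 hAm (measure_ne_top m A) (1 : ℝ) with ha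
  set b : Lp ℝ 2 m := indicatorConstLp 2 hAm.compl (measure_ne_top m Aᶜ) (1 : ℝ) with hb
  have hae : a =ᵐ[m] A.indicator fun _ => (1 : ℝ) := indicatorConstLp_coeFn
  have hbe : b =ᵐ[m] Aᶜ.indicator fun _ => (1 : ℝ) := indicatorConstLp_coeFn
  have ha01 : ∀ᵐ x ∂m, 0 ≤ a x ∧ a x ≤ 1 := by
    filter_upwards [hae] with x hx
    rw [hx]; by_cases hxA : x ∈ A <;> simp [hxA]
  have hb01 : ∀ᵐ x ∂m, 0 ≤ b x ∧ b x ≤ 1 := by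
    filter_upwards [hbe] with x hx
    rw [hx]; by_cases hxA : x ∈ A <;> simp [hxA]
  have hTa := S.markov t ht a ha01
  have hTb := S.markov t ht b hb01
  have e1 : ‖toL1 m h‖ = inner ℝ h (a - b) := by
    rw [L1.norm_eq_integral_norm, L2.inner_def]
    apply integral_congr_ae
    filter_upwards [hae, hbe, Lp.coeFn_sub a b] with x hxa hxb hxs
    rw [coeFn_toL1, hxs, Pi.sub_apply, hxa, hxb]
    by_cases hxA : x ∈ A
    · have : 0 ≤ h x := hxA
      simp [hxA, abs_of_nonneg this]
    · have : h x < 0 := not_le.mp hxA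
      simp [hxA, abs_of_neg this]
  rw [e1, hh, S.symmetric t ht, L2.inner_def, L1.norm_eq_integral_norm]
  refine integral_mono_ae (L2.integrable_inner _ _) (L1.integrable_coeFn _).norm ?_
  have hs : S.T t (a - b) = S.T t a - S.T t b := map_sub _ _ _
  filter_upwards [hTa, hTb, Lp.coeFn_sub (S.T t a) (S.T t b)] with x hxa hxb hxs
  rw [hs, coeFn_toL1]
  have h1 : |(S.T t a - S.T t b : Lp ℝ 2 m) x| ≤ 1 := by
    rw [hxs, Pi.sub_apply, abs_le]
    constructor <;> linarith [hxa.1, hxa.2, hxb.1, hxb.2]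
  refine (real_inner_le_norm _ _).trans ?_
  rw [Real.norm_eq_abs, Real.norm_eq_abs]
  exact mul_le_of_le_one_right (abs_nonneg _) h1

/-- The extension of `T_t` to `L¹(X, m)`: the continuous extension from the dense subspace `L²`. -/
def SymmMarkovSemigroup.T1 (S : SymmMarkovSemigroup m) (t : ℝ) : Lp ℝ 1 m →L[ℝ] Lp ℝ 1 m :=
  ((toL1 m).comp (S.T t).toLinearMap).extendOfNorm (toL1 m)

theorem SymmMarkovSemigroup.T1_toL1 (S : SymmMarkovSemigroup m) {t : ℝ} (ht : 0 ≤ t)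
    (f : Lp ℝ 2 m) : S.T1 t (toL1 m f) = toL1 m (S.T t f) :=
  LinearMap.extendOfNorm_eq denseRange_toL1
    ⟨1, fun f => by simpa using S.norm_toL1_le ht f⟩ f

theorem SymmMarkovSemigroup.norm_T1_le (S : SymmMarkovSemigroup m) {t : ℝ} (ht : 0 ≤ t)
    (f : Lp ℝ 1 m) : ‖S.T1 t f‖ ≤ ‖f‖ := by
  simpa [SymmMarkovSemigroup.T1] using
    LinearMap.norm_extendOfNorm_apply_le (f := (toL1 m).comp (S.T t).toLinearMap)
      denseRange_toL1 1 (fun f => by simpa using S.norm_toL1_le ht f) f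

/-- The truncated Balakrishnan integral
`(1 / (2√π)) ∫_ε^∞ s^{-3/2} (f - T_s f) ds`, a Bochner integral in `L²`. -/
def SymmMarkovSemigroup.truncSqrt (S : SymmMarkovSemigroup m) (ε : ℝ) (f : Lp ℝ 2 m) : Lp ℝ 2 m :=
  (1 / (2 * √Real.pi)) • ∫ s in Set.Ioi ε, (s ^ (-(3 / 2) : ℝ)) • (f - S.T s f)

/-- The graph of `√(-L)` on `L²`, where `L` is the generator of `(T_t)`: `f ∈ D(√(-L))` and
`√(-L) f = g`, through Balakrishnan's formula
`√(-L) f = lim_{ε ↓ 0} (1 / (2√π)) ∫_ε^∞ s^{-3/2} (f - T_s f) ds` in `L²`,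
the domain being the set of all `f` for which the limit exists.
If `E` is the spectral measure of `-L`, the truncated integral is the operator `∫ φ_ε(λ) dE(λ)`
with `φ_ε(λ) = (1 / (2√π)) ∫_ε^∞ s^{-3/2} (1 - e^{-sλ}) ds`, and `φ_ε(λ)` increases to `√λ` as
`ε ↓ 0`; so the limit exists iff `∫ λ d⟨E(λ)f, f⟩ < ∞`, and then it is `∫ √λ dE(λ) f`. -/
def SymmMarkovSemigroup.IsSqrtNegGenerator (S : SymmMarkovSemigroup m) (f g : Lp ℝ 2 m) : Prop :=
  Tendsto (fun ε => S.truncSqrt ε f) (𝓝[>] 0) (𝓝 g)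

/-- `f ∈ D₁(√(-L))` with `√(-L) f = g`: there are `f_n ∈ D(√(-L))` with `f_n → f` and
`√(-L) f_n → g` in `L¹`. -/
def SymmMarkovSemigroup.IsSqrtNegGeneratorL1 (S : SymmMarkovSemigroup m) (f g : Lp ℝ 1 m) : Prop :=
  ∃ F G : ℕ → Lp ℝ 2 m, (∀ n, S.IsSqrtNegGenerator (F n) (G n)) ∧
    Tendsto (fun n => toL1 m (F n)) atTop (𝓝 f) ∧ Tendsto (fun n => toL1 m (G n)) atTop (𝓝 g)

/-- `u s x` is a jointly measurable version of `T_s h (x)`. -/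
def SymmMarkovSemigroup.IsVersion (S : SymmMarkovSemigroup m) (h : Lp ℝ 1 m) (u : ℝ → X → ℝ) :
    Prop :=
  Measurable (Function.uncurry u) ∧ ∀ s : ℝ, 0 ≤ s → u s =ᵐ[m] S.T1 s h

end L1

/-- `A_t h (x) = (1 / t) ∫_t^{2t} T_s h (x) ds`, computed from a version `u s x` of `T_s h (x)`. -/
def avg (u : ℝ → X → ℝ) (t : ℝ) (x : X) : ℝ := (1 / t) * ∫ s in t..(2 * t), u s x

end SymmMarkov

end

/-! Put `g = √(-L) f`. Formally `f = π^{-1/2} ∫₀^∞ s^{-1/2} T_s g ds`, so `f - T_r f` is, up to a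
constant, the integral of `T_s g` against `s^{-1/2} - (s - r)_+^{-1/2}`. The first integral may
diverge, but the difference kernel is `O(r s^{-3/2})` at infinity, hence integrable, and the second
formula always holds. For contraction semigroups this is `smul_sub_eq_integral_diffKernel`: applying
the difference kernel to the truncated Balakrishnan integrals gives exactly an approximate identity
acting on `f - T_r f`. Both sides are `L¹`-continuous, so the formula survives the closure of the
graph (`smul_sub_T1_eq_integral`).

For a single `r` the kernel is singular at `s = r`, which averages over `[s, 2s]` do not control.
Averaging in `r` over `[t, 2t]` removes the singularity and leaves the majorant `s^{-1/2} min(1,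
t/s)` (`lintegral_diffKernel_le`), which decreases and has mass of order `√t`. A decreasing kernel
is dominated by a superposition of averages over `(s, 2s]` (`lintegral_decayKernel_mul_le`).
Together with `|T_s g| ≤ T_s |g|` this is the estimate. Fubini for jointly measurable versions
yields one null set valid for all `t`. -/

noncomputable section

namespace SymmMarkov

/-! ### Scalar kernels -/

/-- `s ↦ s^{-1/2}` on `(0, ∞)`, extended by zero. -/
def invSqrt (s : ℝ) : ℝ := (√s)⁻¹

theorem invSqrt_nonneg (s : ℝ) : 0 ≤ invSqrt s := by unfold invSqrt; positivity

theorem invSqrt_of_nonpos {s : ℝ} (hs : s ≤ 0) : invSqrt s = 0 := by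
  simp [invSqrt, Real.sqrt_eq_zero_of_nonpos hs]

theorem measurable_invSqrt : Measurable invSqrt := by unfold invSqrt; fun_prop

theorem invSqrt_eq_rpow {s : ℝ} (hs : 0 ≤ s) : invSqrt s = s ^ (-(1 / 2) : ℝ) := by
  rw [invSqrt, Real.rpow_neg hs, Real.sqrt_eq_rpow]

theorem rpow_neg_three_halves {s : ℝ} (hs : 0 < s) :
    s ^ (-(3 / 2) : ℝ) = invSqrt s / s := by
  rw [invSqrt_eq_rpow hs.le, ← Real.rpow_sub_one hs.ne']
  norm_num

theorem integrableOn_invSqrt_Ioc (a : ℝ) : IntegrableOn invSqrt (Set.Ioc 0 a) := by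
  rcases le_total a 0 with ha | ha
  · simp [Set.Ioc_eq_empty_of_le ha]
  · have h := (intervalIntegral.intervalIntegrable_rpow' (a := 0) (b := a)
      (r := -(1 / 2)) (by norm_num)).1
    exact h.congr_fun (fun s hs => (invSqrt_eq_rpow hs.1.le).symm) measurableSet_Ioc

theorem integrableOn_invSqrt (a : ℝ) : IntegrableOn invSqrt (Set.Iic a) := by
  have h0 : IntegrableOn invSqrt (Set.Iic 0) :=
    integrableOn_zero.congr_fun (fun s hs => (invSqrt_of_nonpos hs).symm) measurableSet_Iic
  refine (h0.union (integrableOn_invSqrt_Ioc a)).mono_set fun s hs => ?_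
  by_cases h : s ≤ 0
  · exact Or.inl h
  · exact Or.inr ⟨not_le.mp h, hs⟩

theorem setIntegral_invSqrt_Ioc {a : ℝ} (ha : 0 ≤ a) :
    ∫ s in Set.Ioc 0 a, invSqrt s = 2 * √a := by
  rw [setIntegral_congr_fun measurableSet_Ioc fun s hs => invSqrt_eq_rpow hs.1.le,
    ← intervalIntegral.integral_of_le ha, integral_rpow (Or.inl (by norm_num)),
    Real.sqrt_eq_rpow]
  norm_num
  ring

theorem lintegral_invSqrt_Ioc {a : ℝ} (ha : 0 ≤ a) :
    ∫⁻ s in Set.Ioc 0 a, ENNReal.ofReal (invSqrt s) = ENNReal.ofReal (2 * √a) := by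
  rw [← setIntegral_invSqrt_Ioc ha, ofReal_integral_eq_lintegral_ofReal
    (integrableOn_invSqrt_Ioc a) (ae_of_all _ invSqrt_nonneg)]

/-- The kernel `s^{-1/2} - (s - r)_+^{-1/2}` of `√π (1 - T_r) (-L)^{-1/2}`. -/
def diffKernel (r s : ℝ) : ℝ := invSqrt s - invSqrt (s - r)

theorem diffKernel_of_nonpos {r s : ℝ} (hr : 0 ≤ r) (hs : s ≤ 0) : diffKernel r s = 0 := by
  simp [diffKernel, invSqrt_of_nonpos hs, invSqrt_of_nonpos (show s - r ≤ 0 by linarith)]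

theorem measurable_diffKernel : Measurable (Function.uncurry diffKernel) := by
  unfold diffKernel
  exact (measurable_invSqrt.comp measurable_snd).sub
    (measurable_invSqrt.comp (measurable_snd.sub measurable_fst))

/-- With `a = √s`, `b = √(s - r)` the difference is `r / (ab(a + b))` in absolute value, and `a ≤
2b` once `s ≥ 2r`. -/
theorem abs_diffKernel_le {r s : ℝ} (hr : 0 < r) (hs : 2 * r ≤ s) :
    |diffKernel r s| ≤ 2 * r * s ^ (-(3 / 2) : ℝ) := by
  have hs0 : 0 < s := by linarith
  have hsr : 0 < s - r := by linarith
  rw [rpow_neg_three_halves hs0]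
  unfold diffKernel invSqrt
  set a := √s with ha
  set b := √(s - r) with hb
  have ha0 : 0 < a := Real.sqrt_pos.2 hs0
  have hb0 : 0 < b := Real.sqrt_pos.2 hsr
  have ha2 : a * a = s := Real.mul_self_sqrt hs0.le
  have hb2 : b * b = s - r := Real.mul_self_sqrt hsr.le
  have hba : b ≤ a := Real.sqrt_le_sqrt (by linarith)
  have hab : a ≤ 2 * b := by nlinarith
  have h1 : a⁻¹ - b⁻¹ = -((a - b) / (a * b)) := by field_simp; ring
  have h2 : 0 ≤ (a - b) / (a * b) := div_nonneg (by linarith) (by positivity)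
  rw [h1, abs_neg, abs_of_nonneg h2, ← ha2, inv_eq_one_div, div_div, mul_one_div,
    div_le_div_iff₀ (by positivity) (by positivity)]
  have h3 : (a - b) * (a + b) = r := by nlinarith
  have h4 : (a - b) * a ≤ r := by nlinarith
  calc (a - b) * (a * (a * a)) = ((a - b) * a) * (a * a) := by ring
    _ ≤ r * (a * (2 * b)) := by gcongr
    _ = 2 * r * (a * b) := by ring

/-- Neither summand is integrable at infinity; the cancellation is what makes the representation of
`f - T_r f` an absolutely convergent integral. -/
theorem integrable_diffKernel {r : ℝ} (hr : 0 < r) : Integrable (diffKernel r) := by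
  have hm : Measurable (diffKernel r) := measurable_diffKernel.of_uncurry_left
  rw [← integrableOn_univ, ← Set.Iic_union_Ioi (a := 2 * r)]
  refine IntegrableOn.union ?_ ?_
  · refine (integrableOn_invSqrt _).sub ?_
    have h' := (integrable_indicator_iff (measurableSet_Iic (a := r))).2 (integrableOn_invSqrt r)
    have h'' := h'.comp_sub_right r
    rw [← integrable_indicator_iff measurableSet_Iic]
    refine h''.congr (ae_of_all _ fun x => ?_)
    have e : x - r ≤ r ↔ x ≤ 2 * r := by constructor <;> intro <;> linarith
    simp only [Set.indicator, Set.mem_Iic, e]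
  · refine ((integrableOn_Ioi_rpow_of_lt (a := -(3 / 2)) (c := 2 * r) (by norm_num)
      (by linarith)).const_mul (2 * r)).mono' hm.aestronglyMeasurable ?_
    filter_upwards [ae_restrict_mem measurableSet_Ioi] with s hs
    exact abs_diffKernel_le hr (le_of_lt hs)

/-- A decreasing majorant of `s^{-1/2} - (s - t)_+^{-1/2}` after averaging in `t`. -/
def decayKernel (t s : ℝ) : ℝ := invSqrt s * min 1 (t / s)

theorem measurable_decayKernel (t : ℝ) : Measurable (decayKernel t) := by
  unfold decayKernel
  exact measurable_invSqrt.mul (by fun_prop)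

theorem decayKernel_anti {t r s : ℝ} (ht : 0 < t) (hr : 0 < r) (hrs : r ≤ s) :
    decayKernel t s ≤ decayKernel t r := by
  unfold decayKernel invSqrt
  have : 0 < √r := Real.sqrt_pos.2 hr
  have hs : 0 < s := by linarith
  gcongr

theorem lintegral_decayKernel_le {t : ℝ} (ht : 0 < t) :
    ∫⁻ s in Set.Ioi 0, ENNReal.ofReal (decayKernel t s) ≤ ENNReal.ofReal (4 * √t) := by
  have h1 : ∫⁻ s in Set.Ioc 0 t, ENNReal.ofReal (decayKernel t s) ≤ ENNReal.ofReal (2 * √t) := by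
    rw [← lintegral_invSqrt_Ioc ht.le]
    refine lintegral_mono fun s => ENNReal.ofReal_le_ofReal ?_
    exact mul_le_of_le_one_right (invSqrt_nonneg s) (min_le_left _ _)
  have hint := integrableOn_Ioi_rpow_of_lt (a := -(3 / 2)) (c := t) (by norm_num) ht
  have h2 : ∫⁻ s in Set.Ioi t, ENNReal.ofReal (decayKernel t s) ≤ ENNReal.ofReal (2 * √t) := by
    calc _ ≤ ∫⁻ s in Set.Ioi t, ENNReal.ofReal (t * s ^ (-(3 / 2) : ℝ)) := by
          refine setLIntegral_mono (by fun_prop) fun s hs => ENNReal.ofReal_le_ofReal ?_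
          rw [rpow_neg_three_halves (ht.trans hs), mul_div_left_comm]
          exact mul_le_mul_of_nonneg_left (min_le_right _ _) (invSqrt_nonneg s)
      _ = ENNReal.ofReal (∫ s in Set.Ioi t, t * s ^ (-(3 / 2) : ℝ)) := by
          rw [ofReal_integral_eq_lintegral_ofReal (hint.const_mul t)]
          filter_upwards [ae_restrict_mem measurableSet_Ioi] with s hs
          have : 0 < s := ht.trans hs
          positivity
      _ = _ := by
          rw [integral_const_mul, integral_Ioi_rpow_of_lt (by norm_num) ht]
          congr 1
          have : t ^ (-(3 / 2) + 1 : ℝ) = (√t)⁻¹ := by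
            rw [show (-(3 / 2) + 1 : ℝ) = -(1 / 2) by norm_num, ← invSqrt_eq_rpow ht.le, invSqrt]
          rw [this]
          have h0 : 0 < √t := Real.sqrt_pos.2 ht
          field_simp
          rw [Real.sq_sqrt ht.le]
          ring
  rw [← Set.Ioc_union_Ioi_eq_Ioi ht.le]
  refine (lintegral_union_le _ _ _).trans ((add_le_add h1 h2).trans_eq ?_)
  rw [← ENNReal.ofReal_add (by positivity) (by positivity)]
  congr 1
  ring

/-- Far from the singularity (`s ≥ 4t`) the tail bound applies for each `r`. For `s < 4t`,
integrating in `r` turns `(s - r)_+^{-1/2}` into at most `2√s`; the total `s^{-1/2}(t + 2s)` is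
below `9t s^{-1/2}`, and `min(1, t/s) ≥ 1/4` gives `36`. -/
theorem lintegral_diffKernel_le {t s : ℝ} (ht : 0 < t) (hs : 0 < s) :
    ∫⁻ r in Set.Ioc t (2 * t), ENNReal.ofReal |diffKernel r s| ≤
      ENNReal.ofReal (36 * t * decayKernel t s) := by
  have hk := invSqrt_nonneg s
  have hvol : volume (Set.Ioc t (2 * t)) = ENNReal.ofReal t := by
    rw [Real.volume_Ioc]; congr 1; ring
  rcases le_or_gt (4 * t) s with hst | hst
  · have hw : decayKernel t s = t * s ^ (-(3 / 2) : ℝ) := by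
      rw [rpow_neg_three_halves hs, decayKernel, min_eq_right, mul_div_left_comm]
      rw [div_le_one hs]; linarith
    calc _ ≤ ∫⁻ r in Set.Ioc t (2 * t), ENNReal.ofReal (4 * decayKernel t s) := by
          refine setLIntegral_mono measurable_const fun r hr => ENNReal.ofReal_le_ofReal ?_
          refine (abs_diffKernel_le (ht.trans hr.1) (by linarith [hr.2])).trans ?_
          rw [hw]
          have : 0 ≤ s ^ (-(3 / 2) : ℝ) := by positivity
          nlinarith [hr.2]
      _ = ENNReal.ofReal (4 * t * decayKernel t s) := by
          rw [setLIntegral_const, hvol, ← ENNReal.ofReal_mul' ht.le]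
          congr 1; ring
      _ ≤ _ := by
          refine ENNReal.ofReal_le_ofReal ?_
          have : 0 ≤ decayKernel t s := by rw [hw]; positivity
          nlinarith [mul_nonneg ht.le this]
  · have hw : invSqrt s ≤ 4 * decayKernel t s := by
      have : (1 : ℝ) / 4 ≤ min 1 (t / s) := by
        refine le_min (by norm_num) ?_
        rw [div_le_div_iff₀ (by norm_num) hs]; linarith
      unfold decayKernel
      nlinarith
    have hshift : ∫⁻ r in Set.Ioc t (2 * t), ENNReal.ofReal (invSqrt (s - r)) ≤
        ENNReal.ofReal (2 * √s) := by
      rw [← lintegral_invSqrt_Ioc hs.le, ← lintegral_indicator measurableSet_Ioc,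
        ← lintegral_indicator measurableSet_Ioc,
        ← lintegral_sub_left_eq_self (fun r => (Set.Ioc 0 s).indicator
          (fun r => ENNReal.ofReal (invSqrt r)) r) s]
      refine lintegral_mono fun r => Set.indicator_apply_le' (fun hr => ?_) fun _ => zero_le
      by_cases h : s - r ∈ Set.Ioc 0 s
      · rw [Set.indicator_of_mem h]
      · rw [invSqrt_of_nonpos (by by_contra hc; exact h ⟨by linarith, by linarith [hr.1]⟩)]
        simp
    calc _ ≤ ∫⁻ r in Set.Ioc t (2 * t),
          (ENNReal.ofReal (invSqrt s) + ENNReal.ofReal (invSqrt (s - r))) := by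
          refine lintegral_mono fun r => ?_
          dsimp only
          rw [← ENNReal.ofReal_add hk (invSqrt_nonneg _)]
          refine ENNReal.ofReal_le_ofReal ((abs_sub _ _).trans_eq ?_)
          rw [abs_of_nonneg hk, abs_of_nonneg (invSqrt_nonneg _)]
      _ ≤ ENNReal.ofReal (invSqrt s * t) + ENNReal.ofReal (2 * √s) := by
          rw [lintegral_add_left measurable_const, setLIntegral_const, hvol,
            ← ENNReal.ofReal_mul hk]
          gcongr
      _ ≤ _ := by
          rw [← ENNReal.ofReal_add (by positivity) (by positivity)]
          refine ENNReal.ofReal_le_ofReal ?_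
          have h1 : √s = invSqrt s * s := by
            have : 0 < √s := Real.sqrt_pos.2 hs
            rw [invSqrt]; field_simp; rw [Real.sq_sqrt hs.le]
          rw [h1]
          nlinarith [mul_nonneg hk ht.le, mul_le_mul_of_nonneg_left hst.le hk]

/-- Integrals against the decaying kernel are controlled by the averages over `(s, 2s]`. -/
theorem lintegral_decayKernel_mul_le {v : ℝ → ℝ≥0∞} (hv : Measurable v) {M : ℝ≥0∞}
    (hM : ∀ s : ℝ, 0 < s → ∫⁻ r in Set.Ioc s (2 * s), v r ≤ ENNReal.ofReal s * M)
    {t : ℝ} (ht : 0 < t) :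
    ∫⁻ r in Set.Ioi 0, ENNReal.ofReal (decayKernel t r) * v r ≤
      ENNReal.ofReal (8 * √t) * M := by
  set w := fun r => ENNReal.ofReal (decayKernel t r) with hw
  have hwm : Measurable w := (measurable_decayKernel t).ennreal_ofReal
  -- The factor `2 / r` normalizes the interval `[r/2, r)` of length `r/2`. There `s < r ≤ 2s`, and
  -- passing from `r` to the smaller `s` increases both `w` and the reciprocal. After Tonelli the
  -- inner integral is an average over `(s, 2s]`.
  have key : ∀ r ∈ Set.Ioi (0 : ℝ), w r * v r ≤ 2 * ∫⁻ s in Set.Ioi 0,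
      (w s * ENNReal.ofReal s⁻¹) * (Set.Ioc s (2 * s)).indicator v r := by
    intro r hr
    have hr0 : (0 : ℝ) < r := hr
    calc w r * v r = 2 * ∫⁻ s in Set.Ico (r / 2) r, (w r * ENNReal.ofReal r⁻¹) * v r := by
          rw [setLIntegral_const, Real.volume_Ico, show r - r / 2 = r / 2 by ring]
          have : (2 : ℝ≥0∞) * (ENNReal.ofReal r⁻¹ * ENNReal.ofReal (r / 2)) = 1 := by
            rw [← ENNReal.ofReal_mul (by positivity),
              show r⁻¹ * (r / 2) = (2 : ℝ)⁻¹ by field_simp,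
              ENNReal.ofReal_inv_of_pos (by norm_num)]
            simpa using ENNReal.mul_inv_cancel two_ne_zero ENNReal.ofNat_ne_top
          calc w r * v r = (2 * (ENNReal.ofReal r⁻¹ * ENNReal.ofReal (r / 2))) * (w r * v r) := by
                rw [this, one_mul]
            _ = _ := by ring
      _ ≤ 2 * ∫⁻ s in Set.Ico (r / 2) r,
          (w s * ENNReal.ofReal s⁻¹) * (Set.Ioc s (2 * s)).indicator v r := by
          gcongr 2 * ?_
          refine setLIntegral_mono_ae' measurableSet_Ico ?_
          filter_upwards [] with s hs
          have hs0 : 0 < s := by linarith [hs.1]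
          rw [Set.indicator_of_mem (by constructor <;> linarith [hs.1, hs.2])]
          gcongr
          · exact ENNReal.ofReal_le_ofReal (decayKernel_anti ht hs0 hs.2.le)
          · exact hs.2.le
      _ ≤ _ := by
          gcongr 2 * ?_
          exact lintegral_mono_set fun s hs => by
            have := hs.1
            simp only [Set.mem_Ioi]; linarith
  have hmeas : Measurable fun p : ℝ × ℝ =>
      (w p.2 * ENNReal.ofReal p.2⁻¹) * (Set.Ioc p.2 (2 * p.2)).indicator v p.1 := by
    refine Measurable.mul (by fun_prop) ?_
    have : (fun p : ℝ × ℝ => (Set.Ioc p.2 (2 * p.2)).indicator v p.1) =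
        {p : ℝ × ℝ | p.2 < p.1 ∧ p.1 ≤ 2 * p.2}.indicator (fun p => v p.1) := by
      ext p; simp only [Set.indicator, Set.mem_Ioc, Set.mem_ofPred_eq]
    rw [this]
    exact (hv.comp measurable_fst).indicator ((measurableSet_lt measurable_snd measurable_fst).inter
      (measurableSet_le measurable_fst (measurable_snd.const_mul 2)))
  calc _ ≤ ∫⁻ r in Set.Ioi 0, 2 * ∫⁻ s in Set.Ioi 0,
        (w s * ENNReal.ofReal s⁻¹) * (Set.Ioc s (2 * s)).indicator v r :=
        setLIntegral_mono' measurableSet_Ioi key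
    _ = 2 * ∫⁻ s in Set.Ioi 0, ∫⁻ r in Set.Ioi 0,
        (w s * ENNReal.ofReal s⁻¹) * (Set.Ioc s (2 * s)).indicator v r := by
        rw [lintegral_const_mul _ hmeas.lintegral_prod_right', lintegral_lintegral_swap
          hmeas.aemeasurable]
    _ ≤ 2 * ∫⁻ s in Set.Ioi 0, w s * M := by
        gcongr 2 * ?_
        refine setLIntegral_mono' measurableSet_Ioi fun s hs => ?_
        have hs0 : (0 : ℝ) < s := hs
        rw [lintegral_const_mul _ (hv.indicator measurableSet_Ioc), mul_assoc]
        gcongr w s * ?_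
        calc _ ≤ ENNReal.ofReal s⁻¹ * (ENNReal.ofReal s * M) := by
              gcongr
              refine (setLIntegral_le_lintegral _ _).trans ?_
              rw [lintegral_indicator measurableSet_Ioc]
              exact hM s hs0
          _ = M := by
              rw [← mul_assoc, ← ENNReal.ofReal_mul (by positivity), inv_mul_cancel₀ hs0.ne']
              simp
    _ ≤ 2 * (ENNReal.ofReal (4 * √t) * M) := by
        rw [lintegral_mul_const _ hwm]
        gcongr
        exact lintegral_decayKernel_le ht
    _ = _ := by
        rw [← mul_assoc, show (8 * √t) = 2 * (4 * √t) by ring,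
          ENNReal.ofReal_mul (p := 2) (by norm_num)]
        simp

section

/-! ### The truncated Balakrishnan kernel and its convolution with `s^{-1/2}` -/

/-- The kernel `p^{-3/2}` truncated to `(ε, ∞)`. -/
def truncKernel (ε p : ℝ) : ℝ := (Set.Ioi ε).indicator (fun p => p ^ (-(3 / 2) : ℝ)) p

theorem integrable_truncKernel {ε : ℝ} (hε : 0 < ε) : Integrable (truncKernel ε) :=
  (integrable_indicator_iff measurableSet_Ioi).2 (integrableOn_Ioi_rpow_of_lt (by norm_num) hε)

theorem integral_truncKernel {ε : ℝ} (hε : 0 < ε) : ∫ p, truncKernel ε p = 2 / √ε := by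
  unfold truncKernel
  rw [integral_indicator measurableSet_Ioi, integral_Ioi_rpow_of_lt (by norm_num) hε,
    show (-(3 / 2) + 1 : ℝ) = -(1 / 2) by norm_num, ← invSqrt_eq_rpow hε.le, invSqrt]
  field_simp

/-- The integrand has the antiderivative `(2/p) √s / √(p - s)` on `(0, p - ε)`. For `p ≤ ε` both
sides vanish, since the real square root of a nonpositive number is `0`. -/
theorem convolution_invSqrt_truncKernel {ε : ℝ} (hε : 0 < ε) (p : ℝ) :
    Integrable (fun s => invSqrt s * truncKernel ε (p - s)) ∧
      ∫ s, invSqrt s * truncKernel ε (p - s) = 2 / √ε * (√(p - ε) / p) := by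
  have hind : (fun s => invSqrt s * truncKernel ε (p - s)) =
      (Set.Ioo 0 (p - ε)).indicator (fun s => invSqrt s * (p - s) ^ (-(3 / 2) : ℝ)) := by
    ext s
    unfold truncKernel
    rcases le_or_gt s 0 with hs | hs
    · rw [invSqrt_of_nonpos hs, zero_mul, Set.indicator_of_notMem fun h => absurd h.1 hs.not_gt]
    · by_cases h : s < p - ε
      · rw [Set.indicator_of_mem (show s ∈ Set.Ioo 0 (p - ε) from ⟨hs, h⟩),
          Set.indicator_of_mem (show p - s ∈ Set.Ioi ε by simp only [Set.mem_Ioi]; linarith)]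
      · rw [Set.indicator_of_notMem fun h' => h (Set.mem_Ioo.1 h').2,
          Set.indicator_of_notMem fun h' => h (by have := Set.mem_Ioi.1 h'; linarith), mul_zero]
  rw [hind]
  rcases le_or_gt p ε with hp | hp
  · rw [Set.Ioo_eq_empty (sub_nonpos.2 hp).not_gt, Set.indicator_empty,
      Real.sqrt_eq_zero_of_nonpos (sub_nonpos.2 hp)]
    simp
  have hp0 : 0 < p := hε.trans hp
  set H : ℝ → ℝ := fun s => 2 / p * (√s / √(p - s)) with hH
  have hcont : ContinuousOn H (Set.Icc 0 (p - ε)) := by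
    refine ContinuousOn.mul continuousOn_const (ContinuousOn.div (by fun_prop) (by fun_prop) ?_)
    intro s hs
    exact (Real.sqrt_pos.2 (by linarith [hs.2])).ne'
  have hderiv : ∀ s ∈ Set.Ioo 0 (p - ε),
      HasDerivAt H (invSqrt s * (p - s) ^ (-(3 / 2) : ℝ)) s := by
    intro s hs
    have hs0 : 0 < s := hs.1
    have hps : 0 < p - s := by linarith [hs.2]
    have h1 := Real.hasDerivAt_sqrt hs0.ne'
    have h2 := ((hasDerivAt_id s).const_sub p).sqrt hps.ne'
    have h3 := (h1.div h2 (Real.sqrt_pos.2 hps).ne').const_mul (2 / p)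
    refine h3.congr_deriv ?_
    rw [rpow_neg_three_halves hps, invSqrt, invSqrt]
    have ha0 : 0 < √s := Real.sqrt_pos.2 hs0
    have hb0 : 0 < √(p - s) := Real.sqrt_pos.2 hps
    have ha2 : √s ^ 2 = s := Real.sq_sqrt hs0.le
    have hb2 : √(p - s) ^ 2 = p - s := Real.sq_sqrt hps.le
    simp only [id]
    field_simp
    rw [ha2, hb2]
    ring
  have hint : IntegrableOn (fun s => invSqrt s * (p - s) ^ (-(3 / 2) : ℝ))
      (Set.Ioc 0 (p - ε)) := by
    refine intervalIntegral.integrableOn_deriv_of_nonneg hcont hderiv fun s hs => ?_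
    have hps : 0 < p - s := by linarith [hs.2]
    exact mul_nonneg (invSqrt_nonneg s) (Real.rpow_nonneg hps.le _)
  refine ⟨(integrable_indicator_iff measurableSet_Ioo).2 (hint.mono_set Set.Ioo_subset_Ioc_self),
    ?_⟩
  rw [integral_indicator measurableSet_Ioo, ← integral_Ioc_eq_integral_Ioo,
    ← intervalIntegral.integral_of_le (by linarith),
    intervalIntegral.integral_eq_sub_of_hasDerivAt_of_le (by linarith) hcont hderiv
      ((intervalIntegrable_iff_integrableOn_Ioc_of_le (by linarith)).2 hint)]
  simp only [hH, sub_sub_cancel, Real.sqrt_zero, zero_div, mul_zero, sub_zero]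
  ring

/-- The profile of the approximate identity obtained by composing the truncated Balakrishnan
operator with the kernel `s^{-1/2}`. -/
def profile (q : ℝ) : ℝ := 2 * (invSqrt q - √(q - 1) / q)

theorem profile_of_nonpos {q : ℝ} (hq : q ≤ 0) : profile q = 0 := by
  simp [profile, invSqrt_of_nonpos hq, Real.sqrt_eq_zero_of_nonpos (show q - 1 ≤ 0 by linarith)]

theorem measurable_profile : Measurable profile := by
  unfold profile
  exact (measurable_invSqrt.sub (by fun_prop)).const_mul 2

theorem profile_nonneg (q : ℝ) : 0 ≤ profile q := by
  rcases le_or_gt q 0 with hq | hq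
  · rw [profile_of_nonpos hq]
  · have h : √(q - 1) ≤ √q := Real.sqrt_le_sqrt (by linarith)
    have h2 : √(q - 1) / q ≤ √q / q := by gcongr
    have h3 : √q / q = invSqrt q := by rw [Real.sqrt_div_self', invSqrt, one_div]
    unfold profile
    linarith

theorem integrable_profile : Integrable profile := by
  rw [← integrableOn_univ, ← Set.Iic_union_Ioi (a := (1 : ℝ))]
  refine IntegrableOn.union ?_ ?_
  · refine IntegrableOn.congr_fun (f := fun q => 2 * invSqrt q)
      ((integrableOn_invSqrt 1).const_mul 2) (fun q hq => ?_) measurableSet_Iic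
    have hq1 : q - 1 ≤ 0 := sub_nonpos.2 hq
    simp [profile, Real.sqrt_eq_zero_of_nonpos hq1]
  · refine ((integrableOn_Ioi_rpow_of_lt (a := -(3 / 2)) (c := 1) (by norm_num)
      one_pos).const_mul 2).mono' measurable_profile.aestronglyMeasurable ?_
    filter_upwards [ae_restrict_mem measurableSet_Ioi] with q hq
    have hq1 : 1 < q := hq
    have hq0 : 0 < q := one_pos.trans hq1
    rw [Real.norm_of_nonneg (profile_nonneg q), rpow_neg_three_halves hq0, profile]
    have ha0 : 0 < √q := Real.sqrt_pos.2 hq0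
    have ha2 : √q ^ 2 = q := Real.sq_sqrt hq0.le
    have hb0 : 0 ≤ √(q - 1) := Real.sqrt_nonneg _
    have hb2 : √(q - 1) ^ 2 = q - 1 := Real.sq_sqrt (by linarith)
    have hba : √(q - 1) ≤ √q := Real.sqrt_le_sqrt (by linarith)
    gcongr
    have h3 : invSqrt q = √q / q := by rw [Real.sqrt_div_self', invSqrt, one_div]
    rw [show invSqrt q - √(q - 1) / q = (√q - √(q - 1)) / q by rw [h3]; ring]
    gcongr
    -- The claim is `√q (√q - √(q - 1)) ≤ 1`, which holds because `√q √(q - 1) ≥ q - 1`.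
    rw [invSqrt, ← one_div, le_div_iff₀ ha0]
    nlinarith

/-- Only positivity of the mass is needed, to divide by it; its value enters no estimate. -/
theorem integral_profile_pos : 0 < ∫ q, profile q := by
  rw [integral_pos_iff_support_of_nonneg profile_nonneg integrable_profile]
  refine lt_of_lt_of_le ?_ (measure_mono (s := Set.Ioc (0 : ℝ) 1) fun q hq => ?_)
  · simp
  · have : 0 < √q := Real.sqrt_pos.2 hq.1
    rw [Function.mem_support, profile, Real.sqrt_eq_zero_of_nonpos (sub_nonpos.2 hq.2), invSqrt,
      zero_div, sub_zero]
    positivity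

/-- The left side is the mass-preserving dilation of `profile`; the right side is `s^{-1/2}` times
the mass of the truncated kernel, minus their convolution. -/
theorem scaled_profile {ε : ℝ} (hε : 0 < ε) (p : ℝ) :
    ε⁻¹ * profile (p / ε) = 2 / √ε * invSqrt p - 2 / √ε * (√(p - ε) / p) := by
  have h1 : p / ε - 1 = (p - ε) / ε := by field_simp
  have he : 0 < √ε := Real.sqrt_pos.2 hε
  rw [profile, invSqrt, invSqrt, h1, Real.sqrt_div' _ hε.le, Real.sqrt_div' _ hε.le]
  have he2 : ε = √ε * √ε := (Real.mul_self_sqrt hε.le).symm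
  rcases eq_or_ne p 0 with rfl | hp
  · simp
  rcases eq_or_ne (√p) 0 with h0 | h0
  · rw [h0]; simp; rw [he2, Real.sqrt_mul_self he.le]; field_simp
  · rw [he2, Real.sqrt_mul_self he.le]; field_simp

/-! ### Contraction semigroups and the potential representation -/

variable {E : Type*} [NormedAddCommGroup E] [NormedSpace ℝ E]

theorem integrable_kernel_smul {k : ℝ → ℝ} (hk : Integrable k) {u : ℝ → E}
    (hu : AEStronglyMeasurable u volume) {B : ℝ} (hB : ∀ s, ‖u s‖ ≤ B) :
    Integrable fun s => k s • u s :=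
  hk.smul_bdd B hu (ae_of_all _ hB)

theorem tendsto_integral_kernel_smul {k : ℝ → ℝ} (hk : Integrable k) {T : ℝ → E →L[ℝ] E}
    (hm : ∀ f, AEStronglyMeasurable (fun s => T s f) volume) (hT : ∀ s f, ‖T s f‖ ≤ ‖f‖)
    {ι : Type*} {l : Filter ι} {F : ι → E} {f : E} (hF : Tendsto F l (𝓝 f)) :
    Tendsto (fun i => ∫ s, k s • T s (F i)) l (𝓝 (∫ s, k s • T s f)) := by
  rw [tendsto_iff_norm_sub_tendsto_zero] at hF ⊢
  refine squeeze_zero (fun _ => norm_nonneg _) (fun i => ?_)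
    (by simpa using hF.const_mul (∫ s, ‖k s‖))
  rw [← integral_sub (integrable_kernel_smul hk (hm _) fun s => hT s _)
    (integrable_kernel_smul hk (hm _) fun s => hT s _), ← integral_mul_const]
  refine norm_integral_le_of_norm_le (hk.norm.mul_const _) (ae_of_all _ fun s => ?_)
  rw [← smul_sub, ← map_sub, norm_smul]
  exact mul_le_mul_of_nonneg_left (hT s _) (norm_nonneg _)

variable [CompleteSpace E]

/-- By Fubini the left side has kernel `k * (c δ - ρ)`, where `k` is the difference kernel, `ρ` the
truncated one and `c` its mass. This equals `Ψ(p) - Ψ(p - r)` with `Ψ` the dilated profile; the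
translation by `r` is then moved onto `u`, and `p = ε q`. -/
theorem integral_diffKernel_smul_truncKernel {u : ℝ → E} (hu : Continuous u) {B : ℝ}
    (hB : ∀ s, ‖u s‖ ≤ B) {ε r : ℝ} (hε : 0 < ε) (hr : 0 < r) :
    ∫ s, diffKernel r s • ∫ p, truncKernel ε p • (u s - u (s + p)) =
      ∫ q, profile q • (u (ε * q) - u (ε * q + r)) := by
  have hk := integrable_diffKernel hr
  have hρ := integrable_truncKernel hε
  have hum {μ : Measure ℝ} : AEStronglyMeasurable u μ := hu.aestronglyMeasurable
  have hprod : Integrable (fun z : ℝ × ℝ => (diffKernel r z.1 * truncKernel ε (z.2 - z.1)) • u z.2)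
      (volume.prod volume) := by
    have h := (hk.convolution_integrand (ContinuousLinearMap.mul ℝ ℝ) hρ
      (μ := volume) (ν := volume)).swap
    exact h.smul_bdd B (hu.comp continuous_snd).aestronglyMeasurable (ae_of_all _ fun z => hB z.2)
  have hinner : ∀ s, ∫ p, truncKernel ε p • (u s - u (s + p)) =
      (2 / √ε) • u s - ∫ p, truncKernel ε (p - s) • u p := by
    intro s
    simp_rw [smul_sub]
    have hi : Integrable fun p => truncKernel ε p • u (s + p) := integrable_kernel_smul hρ
      (hu.comp (by fun_prop)).aestronglyMeasurable fun p => hB _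
    rw [integral_sub (hρ.smul_const _) hi, integral_smul_const, integral_truncKernel hε]
    congr 1
    rw [← integral_sub_right_eq_self _ s]
    simp only [add_sub_cancel]
  set Ψ : ℝ → ℝ := fun p => ε⁻¹ * profile (p / ε) with hΨ
  have hΨi : Integrable Ψ := (integrable_profile.comp_div hε.ne').const_mul _
  have hconv : ∀ p, ∫ s, diffKernel r s * truncKernel ε (p - s) =
      2 / √ε * diffKernel r p - (Ψ p - Ψ (p - r)) := by
    intro p
    have h1 := convolution_invSqrt_truncKernel hε p
    have h2 := convolution_invSqrt_truncKernel hε (p - r)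
    have e : (fun s => invSqrt (s - r) * truncKernel ε (p - s)) =
        fun s => (fun s => invSqrt s * truncKernel ε (p - r - s)) (s - r) := by
      ext s; simp
    have h3 : Integrable (fun s => invSqrt (s - r) * truncKernel ε (p - s)) := by
      rw [e]; exact h2.1.comp_sub_right r
    simp_rw [diffKernel, sub_mul]
    rw [integral_sub h1.1 h3, e, integral_sub_right_eq_self
      (fun s => invSqrt s * truncKernel ε (p - r - s)) r, h1.2, h2.2]
    simp only [hΨ, scaled_profile hε]
    ring
  have hΨu : Integrable fun p => Ψ p • u p := integrable_kernel_smul hΨi hum hB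
  have hΨu' : Integrable fun p => Ψ p • u (p + r) :=
    integrable_kernel_smul hΨi (hu.comp (by fun_prop)).aestronglyMeasurable fun p => hB _
  have hΨr : Integrable fun p => Ψ (p - r) • u p :=
    integrable_kernel_smul (hΨi.comp_sub_right r) hum hB
  have hku : Integrable fun s => diffKernel r s • u s := integrable_kernel_smul hk hum hB
  have hcku : Integrable fun s => (2 / √ε) • (diffKernel r s • u s) := hku.smul _
  have hΨd : Integrable fun p => Ψ p • u p - Ψ (p - r) • u p := hΨu.sub hΨr
  calc ∫ s, diffKernel r s • ∫ p, truncKernel ε p • (u s - u (s + p))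
      = ∫ s, ((2 / √ε) • (diffKernel r s • u s) -
          ∫ p, (diffKernel r s * truncKernel ε (p - s)) • u p) := by
        refine integral_congr_ae (ae_of_all _ fun s => ?_)
        dsimp only
        rw [hinner, smul_sub, smul_comm, ← integral_smul]
        simp_rw [smul_smul]
    _ = (2 / √ε) • (∫ s, diffKernel r s • u s) -
          ∫ p, ∫ s, (diffKernel r s * truncKernel ε (p - s)) • u p := by
        rw [integral_sub hcku hprod.integral_prod_left, integral_smul,
          integral_integral_swap hprod]
    _ = (2 / √ε) • (∫ s, diffKernel r s • u s) -
          ∫ p, ((2 / √ε) • (diffKernel r p • u p) - (Ψ p • u p - Ψ (p - r) • u p)) := by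
        congr 1
        refine integral_congr_ae (ae_of_all _ fun p => ?_)
        dsimp only
        rw [integral_smul_const, hconv, sub_smul, sub_smul, mul_smul]
    _ = ∫ p, Ψ p • (u p - u (p + r)) := by
        rw [integral_sub hcku hΨd, integral_smul, sub_sub_cancel,
          integral_sub hΨu hΨr]
        simp_rw [smul_sub]
        rw [integral_sub hΨu hΨu']
        congr 1
        rw [← integral_add_right_eq_self _ r]
        simp
    _ = _ := by
        have h := Measure.integral_comp_mul_left
          (fun p => Ψ p • (u p - u (p + r))) ε
        rw [abs_of_pos (inv_pos.2 hε)] at h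
        have h' := (congrArg (fun z => ε • z) h).symm
        simp only [smul_inv_smul₀ hε.ne'] at h'
        rw [h', ← integral_smul]
        refine integral_congr_ae (ae_of_all _ fun q => ?_)
        simp only [hΨ, smul_smul, mul_inv_cancel_left₀ hε.ne', mul_div_cancel_left₀ _ hε.ne']

/-- If `g` is the Balakrishnan limit of `f` for the contraction semigroup `T`, then
`f - T_r f` is, up to a constant, the integral of `T_s g` against `s^{-1/2} - (s - r)_+^{-1/2}`. -/
theorem smul_sub_eq_integral_diffKernel {T : ℝ → E →L[ℝ] E}
    (hc : ∀ f, Continuous fun s => T s f) (hT : ∀ s f, ‖T s f‖ ≤ ‖f‖) (h0 : ∀ f, T 0 f = f)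
    (hadd : ∀ s p, 0 ≤ s → 0 ≤ p → ∀ f, T (s + p) f = T s (T p f)) {f g : E} {a : ℝ}
    (hfg : Tendsto (fun ε : ℝ => a • ∫ p in Set.Ioi ε, (p ^ (-(3 / 2) : ℝ)) • (f - T p f))
      (𝓝[>] 0) (𝓝 g)) {r : ℝ} (hr : 0 < r) :
    (a * ∫ q, profile q) • (f - T r f) = ∫ s, diffKernel r s • T s g := by
  have hm : ∀ f, AEStronglyMeasurable (fun s => T s f) volume :=
    fun f => (hc f).aestronglyMeasurable
  -- Two limits of one family as `ε ↓ 0`: by hypothesis the truncated integrals tend to `g`, while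
  -- after the kernel computation they form an approximate identity at time `0`.
  have h1 := tendsto_integral_kernel_smul (integrable_diffKernel hr) hm hT hfg
  have h2 : Tendsto (fun ε : ℝ => a • ∫ q, profile q • (T (ε * q) f - T (ε * q + r) f))
      (𝓝[>] 0) (𝓝 (a • ∫ q, profile q • (f - T r f))) := by
    refine Tendsto.const_smul ?_ a
    refine tendsto_integral_filter_of_dominated_convergence
      (fun q => ‖profile q‖ * (‖f‖ + ‖f‖)) (Eventually.of_forall fun ε => ?_)
      (Eventually.of_forall fun ε => ae_of_all _ fun q => ?_)
      (integrable_profile.norm.mul_const _) (ae_of_all _ fun q => ?_)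
    · refine measurable_profile.aestronglyMeasurable.smul (Continuous.aestronglyMeasurable ?_)
      exact ((hc f).comp (by fun_prop)).sub ((hc f).comp (by fun_prop))
    · rw [norm_smul]
      gcongr
      exact (norm_sub_le _ _).trans (add_le_add (hT _ _) (hT _ _))
    · refine Tendsto.const_smul ?_ _
      have hcont : Continuous fun ε : ℝ => T (ε * q) f - T (ε * q + r) f :=
        ((hc f).comp (by fun_prop)).sub ((hc f).comp (by fun_prop))
      simpa [h0] using (hcont.tendsto 0).mono_left nhdsWithin_le_nhds
  rw [mul_smul, ← integral_smul_const]
  refine tendsto_nhds_unique (h2.congr' ?_) h1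
  filter_upwards [self_mem_nhdsWithin] with ε hε
  have hε0 : (0 : ℝ) < ε := hε
  rw [← integral_diffKernel_smul_truncKernel (hc f) (fun s => hT s f) hε0 hr, ← integral_smul]
  refine integral_congr_ae (ae_of_all _ fun s => ?_)
  dsimp only
  -- The semigroup law is only available for nonnegative times; the kernel vanishes elsewhere.
  rcases le_or_gt s 0 with hs | hs
  · simp [diffKernel_of_nonpos hr.le hs]
  rw [map_smul, smul_comm]
  congr 2
  have hint : IntegrableOn (fun p : ℝ => (p ^ (-(3 / 2) : ℝ)) • (f - T p f)) (Set.Ioi ε) :=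
    (integrableOn_Ioi_rpow_of_lt (a := -(3 / 2)) (by norm_num) hε0).smul_bdd (‖f‖ + ‖f‖)
      (continuous_const.sub (hc f)).aestronglyMeasurable
      (ae_of_all _ fun p => (norm_sub_le _ _).trans (add_le_add le_rfl (hT p f)))
  rw [← (T s).integral_comp_comm hint, ← integral_indicator measurableSet_Ioi]
  refine integral_congr_ae (ae_of_all _ fun p => ?_)
  simp only [truncKernel, Set.indicator]
  split_ifs with hp
  · rw [map_smul, map_sub, hadd s p hs.le (hε0.trans hp).le]
  · simp

end

section

variable {X : Type*} [MeasurableSpace X]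

/-! ### Jointly measurable versions of `L¹`-valued functions -/

theorem measurable_uncurry_simpleFunc {α : Type*} [MeasurableSpace α] {m : Measure X}
    (φ : SimpleFunc α (Lp ℝ 1 m)) : Measurable fun p : α × X => φ p.1 p.2 := by
  classical
  have e : (fun p : α × X => φ p.1 p.2) =
      fun p => ∑ c ∈ φ.range, if φ p.1 = c then c p.2 else 0 := by
    ext p
    rw [Finset.sum_ite_eq, if_pos (φ.mem_range_self p.1)]
  rw [e]
  refine Finset.measurable_sum _ fun c _ => Measurable.ite ?_ ?_ measurable_const
  · exact measurable_fst (φ.measurableSet_fiber c)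
  · exact (Lp.stronglyMeasurable c).measurable.comp measurable_snd

/-- The errors are summable in `L¹`, so their pointwise sum is finite almost everywhere. -/
theorem ae_tendsto_of_norm_sub_lt {m : Measure X} {G : ℕ → Lp ℝ 1 m} {f : Lp ℝ 1 m}
    (h : ∀ n, ‖G n - f‖ < (1 / 2) ^ n) :
    ∀ᵐ x ∂m, Tendsto (fun n => G n x) atTop (𝓝 (f x)) := by
  have hmeas : ∀ n, Measurable fun x => ‖G n x - f x‖ₑ := fun n =>
    ((Lp.stronglyMeasurable (G n)).measurable.sub (Lp.stronglyMeasurable f).measurable).enorm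
  have hsum : ∫⁻ x, ∑' n, ‖G n x - f x‖ₑ ∂m ≠ ∞ := by
    rw [lintegral_tsum fun n => (hmeas n).aemeasurable]
    simp_rw [← L1.ofReal_norm_sub_eq_lintegral]
    rw [← ENNReal.ofReal_tsum_of_nonneg (fun n => norm_nonneg _)
      (Summable.of_nonneg_of_le (fun n => norm_nonneg _) (fun n => (h n).le)
        summable_geometric_two)]
    exact ENNReal.ofReal_ne_top
  filter_upwards [ae_lt_top (Measurable.tsum hmeas) hsum] with x hx
  rw [tendsto_iff_edist_tendsto_0]
  simp_rw [edist_eq_enorm_sub]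
  exact ENNReal.tendsto_atTop_zero_of_tsum_ne_top hx.ne

theorem exists_measurable_version {α : Type*} [MeasurableSpace α] {m : Measure X}
    {F : α → Lp ℝ 1 m} (hF : StronglyMeasurable F) :
    ∃ w : α → X → ℝ, Measurable (Function.uncurry w) ∧ ∀ a, w a =ᵐ[m] F a := by
  classical
  have hex : ∀ (k : ℕ) (a : α), ∃ n, ‖hF.approx n a - F a‖ < (1 / 2) ^ k := by
    intro k a
    have h := tendsto_iff_norm_sub_tendsto_zero.1 (hF.tendsto_approx a)
    exact (h.eventually (gt_mem_nhds (by positivity))).exists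
  -- The least index with error below `2^{-k}` depends measurably on `a`, so the convergence rate
  -- becomes uniform in `a`.
  let N : ℕ → α → ℕ := fun k a => Nat.find (hex k a)
  have hN : ∀ k, Measurable (N k) := fun k => measurable_find (hex k) fun n =>
    ((hF.approx n).stronglyMeasurable.sub hF).norm.measurable measurableSet_Iio
  let W : ℕ → α × X → ℝ := fun k p => hF.approx (N k p.1) p.1 p.2
  have hW : ∀ k, Measurable (W k) := by
    intro k
    have h : Measurable fun z : ℕ × (α × X) => hF.approx z.1 z.2.1 z.2.2 :=
      measurable_from_prod_countable_right fun n => measurable_uncurry_simpleFunc (hF.approx n)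
    exact h.comp (((hN k).comp measurable_fst).prodMk measurable_id)
  -- A limsup in `EReal` is measurable without any convergence, and equals the limit wherever that
  -- exists.
  refine ⟨fun a x => (limsup (fun k => ((W k (a, x) : ℝ) : EReal)) atTop).toReal, ?_, fun a => ?_⟩
  · exact (Measurable.limsup fun k => (hW k).coe_real_ereal).ereal_toReal
  · filter_upwards [ae_tendsto_of_norm_sub_lt (G := fun k => hF.approx (N k a) a) (f := F a)
      fun k => Nat.find_spec (hex k a)] with x hx
    have h : Tendsto (fun k => ((W k (a, x) : ℝ) : EReal)) atTop (𝓝 ((F a x : ℝ) : EReal)) :=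
      (continuous_coe_real_ereal.tendsto _).comp hx
    rw [h.limsup_eq, EReal.toReal_coe]

/-- Integration over a set as a continuous functional on `L¹`. -/
def setIntegralL1 (m : Measure X) (A : Set X) : Lp ℝ 1 m →L[ℝ] ℝ where
  toFun h := ∫ x in A, h x ∂m
  map_add' f g := by
    rw [← integral_add (L1.integrable_coeFn f).integrableOn (L1.integrable_coeFn g).integrableOn]
    exact integral_congr_ae (ae_restrict_of_ae (Lp.coeFn_add f g))
  map_smul' c f := by
    rw [RingHom.id_apply, ← integral_smul]
    exact integral_congr_ae (ae_restrict_of_ae (Lp.coeFn_smul c f))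
  cont := continuous_setIntegral A

theorem integrable_version {α : Type*} [MeasurableSpace α] {ν : Measure α} [SFinite ν]
    {m : Measure X} [SFinite m] {F : α → Lp ℝ 1 m} (hF : Integrable F ν) {w : α → X → ℝ}
    (hw : Measurable (Function.uncurry w)) (hwF : ∀ᵐ a ∂ν, w a =ᵐ[m] F a) :
    Integrable (Function.uncurry w) (ν.prod m) := by
  rw [integrable_prod_iff hw.aestronglyMeasurable]
  constructor
  · filter_upwards [hwF] with a ha
    exact (L1.integrable_coeFn (F a)).congr ha.symm
  · refine hF.norm.congr ?_
    filter_upwards [hwF] with a ha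
    rw [L1.norm_eq_integral_norm]
    refine integral_congr_ae ?_
    filter_upwards [ha] with x hx
    simp only [Function.uncurry_apply_pair, hx]

/-- The Bochner integral in `L¹` is computed pointwise from a jointly measurable version. -/
theorem coeFn_integral_ae_eq {α : Type*} [MeasurableSpace α] {ν : Measure α} [SFinite ν]
    {m : Measure X} [IsFiniteMeasure m] {F : α → Lp ℝ 1 m} (hF : Integrable F ν) {w : α → X → ℝ}
    (hw : Measurable (Function.uncurry w)) (hwF : ∀ᵐ a ∂ν, w a =ᵐ[m] F a) :
    (∫ a, F a ∂ν : Lp ℝ 1 m) =ᵐ[m] fun x => ∫ a, w a x ∂ν := by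
  have hi := integrable_version hF hw hwF
  refine Integrable.ae_eq_of_forall_setIntegral_eq _ _ (L1.integrable_coeFn _)
    hi.integral_prod_right fun A hA _ => ?_
  have h1 : ∫ x in A, (∫ a, F a ∂ν : Lp ℝ 1 m) x ∂m = ∫ a, ∫ x in A, F a x ∂m ∂ν :=
    ((setIntegralL1 m A).integral_comp_comm hF).symm
  have hiA : Integrable (Function.uncurry w) (ν.prod (m.restrict A)) := by
    have h := hi.restrict (s := Set.univ ×ˢ A)
    rwa [← Measure.prod_restrict, Measure.restrict_univ] at h
  rw [h1, ← integral_integral_swap hiA]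
  refine integral_congr_ae ?_
  filter_upwards [hwF] with a ha
  exact integral_congr_ae (ae_restrict_of_ae ha.symm)

/-! ### The semigroup on `L²` and on `L¹` -/

/-- The contraction property transports right continuity at `0` to two-sided continuity at every
time; `max s 0` extends the orbit to the whole line. -/
theorem SymmMarkovSemigroup.continuous_T {m : Measure X} (S : SymmMarkovSemigroup m)
    (f : Lp ℝ 2 m) : Continuous fun s : ℝ => S.T (max s 0) f := by
  have h0 : Tendsto (fun h : ℝ => ‖S.T |h| f - f‖) (𝓝 0) (𝓝 0) := by
    rw [← tendsto_iff_norm_sub_tendsto_zero, ← nhdsNE_sup_pure, tendsto_sup]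
    refine ⟨(S.strongly_continuous f).comp tendsto_abs_nhdsNE_zero, ?_⟩
    rw [tendsto_pure_left]
    intro s hs
    simpa [S.map_zero] using mem_of_mem_nhds hs
  have hle : ∀ s r : ℝ, 0 ≤ r → r ≤ s → ‖S.T s f - S.T r f‖ ≤ ‖S.T |s - r| f - f‖ := by
    intro s r hr hrs
    have e : S.T s f = S.T r (S.T |s - r| f) := by
      rw [← ContinuousLinearMap.comp_apply, ← S.map_add r _ hr (abs_nonneg _),
        abs_of_nonneg (by linarith)]
      congr 2; ring
    rw [e, ← map_sub]
    exact S.contraction r hr _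
  have hle' : ∀ s r : ℝ, 0 ≤ s → 0 ≤ r → ‖S.T s f - S.T r f‖ ≤ ‖S.T |s - r| f - f‖ := by
    intro s r hs hr
    rcases le_total r s with h | h
    · exact hle s r hr h
    · rw [norm_sub_rev, abs_sub_comm]
      exact hle r s hs h
  refine continuous_iff_continuousAt.2 fun r => tendsto_iff_norm_sub_tendsto_zero.2 ?_
  refine squeeze_zero (fun _ => norm_nonneg _)
    (fun s => hle' _ _ (le_max_right _ _) (le_max_right _ _)) (h0.comp ?_)
  have : Continuous fun s : ℝ => max s 0 - max r 0 := by fun_prop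
  simpa using this.tendsto r

variable {m : Measure X} [IsProbabilityMeasure m]

variable (m) in
/-- The inclusion `L²(m) ⊆ L¹(m)` as a continuous linear map. -/
def toL1CLM : Lp ℝ 2 m →L[ℝ] Lp ℝ 1 m :=
  (toL1 m).mkContinuous 1 fun f => by
    rw [one_mul, Lp.norm_def, Lp.norm_def]
    refine ENNReal.toReal_mono (Lp.eLpNorm_ne_top f) ?_
    exact eLpNorm_le_eLpNorm_of_exponent_le one_le_two (Lp.aestronglyMeasurable f)

theorem toL1CLM_apply (f : Lp ℝ 2 m) : toL1CLM m f = toL1 m f := rfl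

namespace SymmMarkovSemigroup

variable (S : SymmMarkovSemigroup m)

/-- An `L¹` orbit is a pointwise limit of orbits of `L²` functions, which are continuous in `L¹`. -/
theorem stronglyMeasurable_T1 (h : Lp ℝ 1 m) :
    StronglyMeasurable fun s : ℝ => S.T1 (max s 0) h := by
  obtain ⟨_, hF, hlim⟩ := mem_closure_iff_seq_limit.1 (denseRange_toL1 (m := m) h)
  choose F hF using hF
  refine stronglyMeasurable_of_tendsto atTop (f := fun n s => toL1CLM m (S.T (max s 0) (F n)))
    (fun n => ((toL1CLM m).continuous.comp (S.continuous_T (F n))).stronglyMeasurable) ?_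
  rw [tendsto_pi_nhds]
  intro s
  simp_rw [toL1CLM_apply, ← S.T1_toL1 (le_max_right s 0), hF]
  exact ((S.T1 _).continuous.tendsto h).comp hlim

theorem exists_isVersion (h : Lp ℝ 1 m) : ∃ u, S.IsVersion h u := by
  obtain ⟨w, hw, hwF⟩ := exists_measurable_version (S.stronglyMeasurable_T1 h)
  refine ⟨w, hw, fun s hs => ?_⟩
  simpa [max_eq_left hs] using hwF s

/-- Nonnegative simple functions are dense in the positive cone, and being bounded they can be
scaled into `[0, 1]`, where the Markov property applies. -/
theorem T1_nonneg {t : ℝ} (ht : 0 ≤ t) {h : Lp ℝ 1 m} (hh : 0 ≤ h) : 0 ≤ S.T1 t h := by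
  have hd := Lp.simpleFunc.denseRange_coeSimpleFuncNonnegToLpNonneg 1 m ℝ ENNReal.one_ne_top
  refine hd.induction_on (p := fun g => 0 ≤ S.T1 t g) ⟨h, hh⟩
    (isClosed_le continuous_const ((S.T1 t).continuous.comp continuous_subtype_val)) ?_
  rintro ⟨φ, hφ⟩
  obtain ⟨c, hc⟩ := (Lp.simpleFunc.toSimpleFunc φ).exists_forall_norm_le
  have hφ2 : MemLp (Lp.simpleFunc.toSimpleFunc φ) 2 m := SimpleFunc.memLp_of_isFiniteMeasure _ _ _
  set F : Lp ℝ 2 m := hφ2.toLp _ with hF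
  have hFφ : F =ᵐ[m] Lp.simpleFunc.toSimpleFunc φ := hφ2.coeFn_toLp
  have e : toL1 m F = φ := by
    apply Lp.ext
    rw [coeFn_toL1]
    exact hFφ.trans (Lp.simpleFunc.toSimpleFunc_eq_toFun φ)
  set d : ℝ := max c 1
  have hd0 : 0 < d := one_pos.trans_le (le_max_right _ _)
  have hF01 : ∀ᵐ x ∂m, 0 ≤ (d⁻¹ • F) x ∧ (d⁻¹ • F) x ≤ 1 := by
    have hφ0 : (0 : Lp ℝ 1 m) ≤ φ := hφ
    filter_upwards [hFφ, Lp.coeFn_smul d⁻¹ F, Lp.simpleFunc.toSimpleFunc_eq_toFun φ,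
      (Lp.coeFn_nonneg _).2 hφ0] with x h1 h2 h3 h4
    rw [h2, Pi.smul_apply, h1, smul_eq_mul]
    have h5 : 0 ≤ Lp.simpleFunc.toSimpleFunc φ x := by rw [h3]; exact h4
    refine ⟨by positivity, ?_⟩
    rw [inv_mul_le_iff₀ hd0, mul_one]
    exact (le_abs_self _).trans ((hc x).trans (le_max_left _ _))
  change 0 ≤ S.T1 t φ
  rw [← e, S.T1_toL1 ht, ← Lp.coeFn_nonneg, coeFn_toL1]
  have e2 : S.T t F = d • S.T t (d⁻¹ • F) := by rw [← map_smul, smul_inv_smul₀ hd0.ne']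
  rw [e2]
  filter_upwards [S.markov t ht _ hF01, Lp.coeFn_smul d (S.T t (d⁻¹ • F))] with x h1 h2
  rw [h2, Pi.smul_apply, smul_eq_mul]
  exact mul_nonneg hd0.le h1.1

theorem abs_T1_le {t : ℝ} (ht : 0 ≤ t) (g : Lp ℝ 1 m) : |S.T1 t g| ≤ S.T1 t |g| := by
  refine sup_le ?_ ?_
  · rw [← sub_nonneg, ← map_sub]
    exact S.T1_nonneg ht (sub_nonneg.2 (le_abs_self g))
  · rw [← sub_nonneg, ← map_neg, ← map_sub]
    exact S.T1_nonneg ht (sub_nonneg.2 (neg_le_abs g))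

/-- The representation of `f - T_r f` through `T_s √(-L) f` in `L¹`. -/
theorem smul_sub_T1_eq_integral {f g : Lp ℝ 1 m} (hfg : S.IsSqrtNegGeneratorL1 f g) {r : ℝ}
    (hr : 0 < r) :
    (1 / (2 * √Real.pi) * ∫ q, profile q) • (f - S.T1 r f) =
      ∫ s, diffKernel r s • S.T1 (max s 0) g := by
  obtain ⟨F, G, hFG, hF, hG⟩ := hfg
  have hk := integrable_diffKernel hr
  have hL2 : ∀ n, (1 / (2 * √Real.pi) * ∫ q, profile q) • (toL1 m (F n) - S.T1 r (toL1 m (F n))) =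
      ∫ s, diffKernel r s • S.T1 (max s 0) (toL1 m (G n)) := by
    intro n
    have h := smul_sub_eq_integral_diffKernel (T := fun s => S.T (max s 0)) (f := F n) (g := G n)
      (a := 1 / (2 * √Real.pi)) S.continuous_T (fun s => S.contraction _ (le_max_right _ _))
      (fun f => by simp [S.map_zero]) (fun s p hs hp f => by
        rw [max_eq_left hs, max_eq_left hp, max_eq_left (add_nonneg hs hp), S.map_add s p hs hp]
        rfl) ?_ hr
    · have h' := congrArg (toL1CLM m) h
      rw [← ContinuousLinearMap.integral_comp_comm _ (integrable_kernel_smul hk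
        (S.continuous_T _).aestronglyMeasurable
        fun s => S.contraction _ (le_max_right _ _) _)] at h'
      simp_rw [map_smul, map_sub, toL1CLM_apply, max_eq_left hr.le] at h'
      rw [S.T1_toL1 hr.le, h']
      simp_rw [S.T1_toL1 (le_max_right _ (0 : ℝ))]
    · refine (hFG n).congr' ?_
      filter_upwards [self_mem_nhdsWithin] with ε hε
      rw [truncSqrt]
      congr 1
      refine setIntegral_congr_fun measurableSet_Ioi fun p hp => ?_
      have : (0 : ℝ) ≤ p := (lt_trans hε hp).le
      simp only [max_eq_left this]
  -- The right side converges because integration against an integrable kernel is bounded on `L¹`;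
  -- the left side because `T_r` is.
  have hlim := tendsto_integral_kernel_smul hk (T := fun s => S.T1 (max s 0))
    (fun h => (S.stronglyMeasurable_T1 h).aestronglyMeasurable)
    (fun s h => S.norm_T1_le (le_max_right _ _) h) hG
  refine tendsto_nhds_unique ?_ hlim
  simp_rw [← hL2]
  exact (hF.sub (((S.T1 r).continuous.tendsto f).comp hF)).const_smul _

end SymmMarkovSemigroup

end

section

/-! ### Pointwise estimates -/

/-- The constant in the representation of `f - T_r f`. -/
def potentialConst : ℝ := 1 / (2 * √Real.pi) * ∫ q, profile q

theorem potentialConst_pos : 0 < potentialConst :=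
  mul_pos (by positivity) integral_profile_pos

theorem ofReal_abs_avg_sub_le {X : Type*} {u : ℝ → X → ℝ} {t : ℝ} (ht : 0 < t) {x : X} (a : ℝ)
    (hu : IntervalIntegrable (fun s => u s x) volume t (2 * t)) :
    ENNReal.ofReal |avg u t x - a| ≤
      ENNReal.ofReal t⁻¹ * ∫⁻ r in Set.Ioc t (2 * t), ENNReal.ofReal |u r x - a| := by
  have h : avg u t x - a = t⁻¹ * ∫ r in Set.Ioc t (2 * t), (u r x - a) := by
    rw [← intervalIntegral.integral_of_le (by linarith),
      intervalIntegral.integral_sub hu intervalIntegrable_const, intervalIntegral.integral_const,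
      avg, smul_eq_mul]
    field_simp
    ring
  rw [h, abs_mul, abs_of_pos (inv_pos.2 ht), ENNReal.ofReal_mul (inv_pos.2 ht).le]
  gcongr
  simp_rw [← Real.enorm_eq_ofReal_abs]
  exact enorm_integral_le_lintegral_enorm _

theorem lintegral_ofReal_eq_avg {X : Type*} {v : ℝ → X → ℝ} {s : ℝ} (hs : 0 < s) {x : X}
    (hv : IntervalIntegrable (fun r => v r x) volume s (2 * s))
    (hv0 : ∀ᵐ r ∂volume.restrict (Set.Ioi (0 : ℝ)), 0 ≤ v r x) :
    ∫⁻ r in Set.Ioc s (2 * s), ENNReal.ofReal (v r x) =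
      ENNReal.ofReal s * ENNReal.ofReal (avg v s x) := by
  have hsub : Set.Ioc s (2 * s) ⊆ Set.Ioi 0 := fun r hr => hs.trans hr.1
  rw [← ENNReal.ofReal_mul hs.le, avg, ← mul_assoc, mul_one_div_cancel hs.ne', one_mul,
    intervalIntegral.integral_of_le (by linarith), ofReal_integral_eq_lintegral_ofReal hv.1
      (ae_restrict_of_ae_restrict_of_subset hsub hv0)]

variable {X : Type*} [MeasurableSpace X] {m : Measure X} [IsProbabilityMeasure m]

namespace SymmMarkovSemigroup

variable {S : SymmMarkovSemigroup m} {f g : Lp ℝ 1 m} {u v : ℝ → X → ℝ}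

theorem IsVersion.ae_abs_le (hu : S.IsVersion g u) (hv : S.IsVersion |g| v) :
    ∀ᵐ x ∂m, ∀ᵐ s ∂volume.restrict (Set.Ioi (0 : ℝ)), |u s x| ≤ v s x := by
  -- For each `s` the inequality fails on a null set depending on `s`; joint measurability allows
  -- the quantifiers to be exchanged.
  rw [← Measure.ae_ae_comm (p := fun s x => |u s x| ≤ v s x)
    (measurableSet_le (continuous_abs.measurable.comp hu.1) hv.1)]
  filter_upwards [ae_restrict_mem measurableSet_Ioi] with s hs
  have hs0 : (0 : ℝ) ≤ s := le_of_lt hs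
  filter_upwards [hu.2 s hs0, hv.2 s hs0, Lp.coeFn_abs (S.T1 s g),
    (Lp.coeFn_le _ _).2 (S.abs_T1_le hs0 g)] with x h1 h2 h3 h4
  rw [h1, h2, ← h3]
  exact h4

theorem IsVersion.ae_intervalIntegrable (hu : S.IsVersion f u) :
    ∀ᵐ x ∂m, ∀ t : ℝ, 0 < t → IntervalIntegrable (fun s => u s x) volume t (2 * t) := by
  -- The countably many intervals `(0, n]` give one null set for all real `t`.
  have h : ∀ n : ℕ, ∀ᵐ x ∂m, Integrable (fun s => u s x) (volume.restrict (Set.Ioc 0 (n : ℝ))) := by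
    intro n
    refine (integrable_version (F := fun s => S.T1 (max s 0) f)
      (Integrable.of_bound
        (S.stronglyMeasurable_T1 f).aestronglyMeasurable ‖f‖
        (ae_of_all _ fun s => S.norm_T1_le (le_max_right _ _) f)) hu.1 ?_).prod_left_ae
    filter_upwards [ae_restrict_mem measurableSet_Ioc] with s hs
    rw [max_eq_left hs.1.le]
    exact hu.2 s hs.1.le
  filter_upwards [ae_all_iff.2 h] with x hx t ht
  obtain ⟨n, hn⟩ := exists_nat_ge (2 * t)
  rw [intervalIntegrable_iff_integrableOn_Ioc_of_le (by linarith)]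
  exact IntegrableOn.mono_set (hx n) (Set.Ioc_subset_Ioc ht.le hn)

/-- For a fixed time `r`, the increment `T_r f - f` is dominated pointwise by an integral of
`T_s |√(-L) f|`. -/
theorem IsSqrtNegGeneratorL1.ae_abs_sub_le (hfg : S.IsSqrtNegGeneratorL1 f g)
    (hu : S.IsVersion f u) (hv : S.IsVersion |g| v) {r : ℝ} (hr : 0 < r) :
    ∀ᵐ x ∂m, ENNReal.ofReal |u r x - f x| ≤ ENNReal.ofReal potentialConst⁻¹ *
      ∫⁻ s in Set.Ioi 0, ENNReal.ofReal |diffKernel r s| * ENNReal.ofReal (v s x) := by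
  obtain ⟨w, hw⟩ := S.exists_isVersion g
  have hrep := S.smul_sub_T1_eq_integral hfg hr
  have hint : Integrable fun s => diffKernel r s • S.T1 (max s 0) g :=
    integrable_kernel_smul (integrable_diffKernel hr)
      (S.stronglyMeasurable_T1 g).aestronglyMeasurable fun s => S.norm_T1_le (le_max_right _ _) g
  have hkm : Measurable (diffKernel r) := measurable_diffKernel.of_uncurry_left
  have hpt := coeFn_integral_ae_eq hint (w := fun s x => diffKernel r s * w s x)
    ((hkm.comp measurable_fst).mul hw.1) (ae_of_all _ fun s => ?_)
  · rw [← hrep] at hpt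
    filter_upwards [hpt, Lp.coeFn_smul potentialConst (f - S.T1 r f), Lp.coeFn_sub f (S.T1 r f),
      hu.2 r hr.le, hw.ae_abs_le hv] with x h1 h2 h3 h4 h5
    have h6 : potentialConst * (f x - u r x) = ∫ s in Set.Ioi 0, diffKernel r s * w s x := by
      rw [setIntegral_eq_integral_of_forall_compl_eq_zero fun s hs => by
        rw [diffKernel_of_nonpos hr.le (not_lt.1 hs), zero_mul], ← h1, h4]
      change _ = (potentialConst • (f - S.T1 r f) : Lp ℝ 1 m) x
      rw [h2, Pi.smul_apply, h3, Pi.sub_apply, smul_eq_mul]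
    have h7 : u r x - f x = -(potentialConst⁻¹ * ∫ s in Set.Ioi 0, diffKernel r s * w s x) := by
      rw [← h6, inv_mul_cancel_left₀ potentialConst_pos.ne']; ring
    rw [h7, abs_neg, abs_mul, abs_of_pos (inv_pos.2 potentialConst_pos),
      ENNReal.ofReal_mul (inv_pos.2 potentialConst_pos).le, ← Real.enorm_eq_ofReal_abs]
    gcongr
    refine (enorm_integral_le_lintegral_enorm _).trans (lintegral_mono_ae ?_)
    filter_upwards [h5] with s hs
    rw [Real.enorm_eq_ofReal_abs, abs_mul, ENNReal.ofReal_mul (abs_nonneg _)]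
    gcongr
  · rcases le_or_gt s 0 with hs | hs
    · simp only [diffKernel_of_nonpos hr.le hs, zero_mul, zero_smul]
      exact (Lp.coeFn_zero ℝ 1 m).symm
    · rw [max_eq_left hs.le]
      filter_upwards [hw.2 s hs.le, Lp.coeFn_smul (diffKernel r s) (S.T1 s g)] with x h1 h2
      rw [h2, Pi.smul_apply, h1, smul_eq_mul]

theorem IsSqrtNegGeneratorL1.ae_ae_abs_sub_le (hfg : S.IsSqrtNegGeneratorL1 f g)
    (hu : S.IsVersion f u) (hv : S.IsVersion |g| v) :
    ∀ᵐ x ∂m, ∀ᵐ r ∂volume.restrict (Set.Ioi (0 : ℝ)), ENNReal.ofReal |u r x - f x| ≤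
      ENNReal.ofReal potentialConst⁻¹ *
        ∫⁻ s in Set.Ioi 0, ENNReal.ofReal |diffKernel r s| * ENNReal.ofReal (v s x) := by
  have hmeas : Measurable fun q : (ℝ × X) × ℝ =>
      ENNReal.ofReal |diffKernel q.1.1 q.2| * ENNReal.ofReal (v q.2 q.1.2) := by
    refine Measurable.mul (Measurable.ennreal_ofReal (continuous_abs.measurable.comp ?_))
      (Measurable.ennreal_ofReal ?_)
    · exact measurable_diffKernel.comp
        ((measurable_fst.comp measurable_fst).prodMk measurable_snd)
    · exact hv.1.comp (measurable_snd.prodMk (measurable_snd.comp measurable_fst))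
  have hset := measurableSet_le (Measurable.ennreal_ofReal (continuous_abs.measurable.comp
    (hu.1.sub ((Lp.stronglyMeasurable f).measurable.comp measurable_snd))))
    ((hmeas.lintegral_prod_right' (ν := volume.restrict (Set.Ioi 0))).const_mul
      (ENNReal.ofReal potentialConst⁻¹))
  rw [← Measure.ae_ae_comm (p := fun r x => ENNReal.ofReal |u r x - f x| ≤
    ENNReal.ofReal potentialConst⁻¹ * ∫⁻ s in Set.Ioi 0,
      ENNReal.ofReal |diffKernel r s| * ENNReal.ofReal (v s x)) hset]
  filter_upwards [ae_restrict_mem measurableSet_Ioi] with r hr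
  exact hfg.ae_abs_sub_le hu hv hr

end SymmMarkovSemigroup

/-- The maximal inequality for averages, for almost every point and all times simultaneously. -/
theorem SymmMarkovSemigroup.IsSqrtNegGeneratorL1.ae_abs_avg_sub_le {S : SymmMarkovSemigroup m}
    {f g : Lp ℝ 1 m} {u v : ℝ → X → ℝ} (hfg : S.IsSqrtNegGeneratorL1 f g)
    (hu : S.IsVersion f u) (hv : S.IsVersion |g| v) :
    ∀ᵐ x ∂m,
      (∀ t : ℝ, 0 < t →
        IntervalIntegrable (fun s => u s x) volume t (2 * t) ∧
        IntervalIntegrable (fun s => v s x) volume t (2 * t)) ∧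
      ∀ t : ℝ, 0 < t →
        ENNReal.ofReal |avg u t x - f x| ≤
          ENNReal.ofReal (288 * potentialConst⁻¹ * √t) *
            ⨆ (s : ℝ) (_ : 0 < s), ENNReal.ofReal (avg v s x) := by
  have hc := inv_pos.2 potentialConst_pos
  -- An auxiliary version of `T_s g`, used only to get `v ≥ 0` for almost every time from `|w| ≤ v`.
  obtain ⟨w, hw⟩ := S.exists_isVersion g
  filter_upwards [hu.ae_intervalIntegrable, hv.ae_intervalIntegrable, hw.ae_abs_le hv,
    hfg.ae_ae_abs_sub_le hu hv] with x hux hvx hwv hle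
  refine ⟨fun t ht => ⟨hux t ht, hvx t ht⟩, fun t ht => ?_⟩
  have hv0 : ∀ᵐ r ∂volume.restrict (Set.Ioi (0 : ℝ)), 0 ≤ v r x := by
    filter_upwards [hwv] with r hr using (abs_nonneg _).trans hr
  set M := ⨆ (s : ℝ) (_ : 0 < s), ENNReal.ofReal (avg v s x)
  have hVm : Measurable fun s => ENNReal.ofReal (v s x) :=
    (hv.1.comp (measurable_id.prodMk measurable_const)).ennreal_ofReal
  have hmax := lintegral_decayKernel_mul_le hVm (M := M) (fun s hs => by
    rw [lintegral_ofReal_eq_avg hs (hvx s hs) hv0]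
    gcongr
    exact le_iSup₂_of_le s hs le_rfl) ht
  have hkm : Measurable fun q : ℝ × ℝ =>
      ENNReal.ofReal |diffKernel q.1 q.2| * ENNReal.ofReal (v q.2 x) :=
    (Measurable.ennreal_ofReal (continuous_abs.measurable.comp measurable_diffKernel)).mul
      (hVm.comp measurable_snd)
  have hsub : Set.Ioc t (2 * t) ⊆ Set.Ioi 0 := fun r hr => ht.trans hr.1
  calc ENNReal.ofReal |avg u t x - f x|
      ≤ ENNReal.ofReal t⁻¹ * ∫⁻ r in Set.Ioc t (2 * t), ENNReal.ofReal |u r x - f x| :=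
        ofReal_abs_avg_sub_le ht _ (hux t ht)
    _ ≤ ENNReal.ofReal t⁻¹ * ∫⁻ r in Set.Ioc t (2 * t), ENNReal.ofReal potentialConst⁻¹ *
          ∫⁻ s in Set.Ioi 0, ENNReal.ofReal |diffKernel r s| * ENNReal.ofReal (v s x) := by
        gcongr ENNReal.ofReal t⁻¹ * ?_
        exact lintegral_mono_ae (ae_restrict_of_ae_restrict_of_subset hsub hle)
    _ = ENNReal.ofReal t⁻¹ * (ENNReal.ofReal potentialConst⁻¹ * ∫⁻ s in Set.Ioi 0,
          (∫⁻ r in Set.Ioc t (2 * t), ENNReal.ofReal |diffKernel r s|) *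
            ENNReal.ofReal (v s x)) := by
        rw [lintegral_const_mul _ hkm.lintegral_prod_right',
          lintegral_lintegral_swap hkm.aemeasurable]
        congr 3
        ext s
        exact lintegral_mul_const' (ENNReal.ofReal (v s x))
          (fun r => ENNReal.ofReal |diffKernel r s|) ENNReal.ofReal_ne_top
    _ ≤ ENNReal.ofReal t⁻¹ * (ENNReal.ofReal potentialConst⁻¹ * ∫⁻ s in Set.Ioi 0,
          ENNReal.ofReal (36 * t) *
            (ENNReal.ofReal (decayKernel t s) * ENNReal.ofReal (v s x))) := by
        gcongr ENNReal.ofReal t⁻¹ * (_ * ?_)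
        refine setLIntegral_mono' measurableSet_Ioi fun s hs => ?_
        rw [← mul_assoc, ← ENNReal.ofReal_mul (by positivity)]
        gcongr
        exact lintegral_diffKernel_le ht hs
    _ ≤ ENNReal.ofReal t⁻¹ * (ENNReal.ofReal potentialConst⁻¹ * (ENNReal.ofReal (36 * t) *
          (ENNReal.ofReal (8 * √t) * M))) := by
        rw [lintegral_const_mul' _ _ ENNReal.ofReal_ne_top]
        gcongr
    -- Here `288 = 36 · 8`, and `t⁻¹` cancels the `t` of the kernel bound.
    _ = ENNReal.ofReal (288 * potentialConst⁻¹ * √t) * M := by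
        rw [← mul_assoc, ← mul_assoc, ← mul_assoc, ← ENNReal.ofReal_mul (by positivity),
          ← ENNReal.ofReal_mul (by positivity), ← ENNReal.ofReal_mul (by positivity)]
        congr 2
        field_simp
        ring

end

end SymmMarkov

end

theorem mainTheorem5 :
    ∃ C : ℝ, 0 < C ∧
      ∀ (X : Type*) [MeasurableSpace X] (m : Measure X) [IsProbabilityMeasure m]
        (S : SymmMarkov.SymmMarkovSemigroup m) (f g : Lp ℝ 1 m),
        S.IsSqrtNegGeneratorL1 f g →
          (∃ u, S.IsVersion f u) ∧ (∃ v, S.IsVersion |g| v) ∧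
          ∀ u v : ℝ → X → ℝ, S.IsVersion f u → S.IsVersion |g| v →
            ∀ᵐ x ∂m,
              (∀ t : ℝ, 0 < t →
                IntervalIntegrable (fun s => u s x) volume t (2 * t) ∧
                IntervalIntegrable (fun s => v s x) volume t (2 * t)) ∧
              ∀ t : ℝ, 0 < t →
                ENNReal.ofReal |SymmMarkov.avg u t x - f x| ≤
                  ENNReal.ofReal (C * √t) *
                    ⨆ (s : ℝ) (_ : 0 < s), ENNReal.ofReal (SymmMarkov.avg v s x) := by
  have hc := inv_pos.2 SymmMarkov.potentialConst_pos
  -- The constant comes from scalar kernels alone, hence is independent of the space and the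
  -- semigroup.
  exact ⟨288 * SymmMarkov.potentialConst⁻¹, by positivity, fun X _ m _ S f g hfg =>
    ⟨S.exists_isVersion f, S.exists_isVersion |g|, fun u v hu hv => hfg.ae_abs_avg_sub_le hu hv⟩⟩
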